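/- Let $S^2$ be the unit sphere of $\mathbb{R}^3$ with the spherical (angular) distance. For two different points $a,b\in S^2$ with $a\neq -b$, the arc $ab$ is the shorter part of the great circle through $a$ and $b$. A set $C\subset S^2$ is convex if it contains no pair of antipodes and contains, with every two of its points, the arc connecting them; a spherical convex body is a closed convex set with non-empty interior. The hemisphere with center $m$ is the set of points at distance at most $\frac{\pi}{2}$ from $m$; it supports a convex body $C$ if it contains $C$ and the great circle bounding it passes through a boundary point of $C$. If $G,H$ are hemispheres that are different and not opposite, $G\cap H$ is called a lune, and its thickness is the distance between the centers (midpoints) of the two semicircles bounding it. For a hemisphere $K$ supporting $C$, the width of $C$ determined by $K$ is the minimum of the thicknesses of the lunes $K\cap K'$ over all hemispheres $K'$, different from $K$ and not opposite to $K$, which support $C$. The body $C$ is of constant width $w$ if the width of $C$ determined by $K$ equals $w$ for every hemisphere $K$ supporting $C$. Theorem. Every spherical convex body $W\subset S^2$ of constant width $w<\frac{\pi}{2}$ is strictly convex, i.e. the boundary of $W$ contains no arc $ab$ with $a\neq b$, $a\neq -b$. -/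

import Mathlib

noncomputable section

namespace SphericalGeometry

/-- The unit sphere of Euclidean three-space, with its subspace topology and the antipodal map
`x ↦ -x`. -/
abbrev S2 : Type := Metric.sphere (0 : EuclideanSpace ℝ (Fin 3)) 1

/-- Spherical distance: the angle between the two unit vectors, i.e. the length of the shorter
part of a great circle joining them. -/
def sdist (a b : S2) : ℝ :=
  InnerProductGeometry.angle (a : EuclideanSpace ℝ (Fin 3)) (b : EuclideanSpace ℝ (Fin 3))

/-- The spherical arc `ab`: the points of the sphere in the cone spanned by `a` and `b`. For
distinct non-antipodal points this is the shorter part of the great circle through `a` and `b`;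
for `a = b` it is `{a}`. It is only used for non-antipodal points. -/
def arc (a b : S2) : Set S2 :=
  {x | ∃ s t : ℝ, 0 ≤ s ∧ 0 ≤ t ∧
    (x : EuclideanSpace ℝ (Fin 3)) =
      s • (a : EuclideanSpace ℝ (Fin 3)) + t • (b : EuclideanSpace ℝ (Fin 3))}

/-- Spherical convexity: no pair of antipodes, and closed under taking arcs. -/
def IsSphConvex (C : Set S2) : Prop :=
  (∀ a ∈ C, -a ∉ C) ∧ ∀ a ∈ C, ∀ b ∈ C, arc a b ⊆ C

/-- A spherical convex body: a closed convex set with non-empty interior. -/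
def IsConvexBody (C : Set S2) : Prop :=
  IsClosed C ∧ IsSphConvex C ∧ (interior C).Nonempty

/-- A body is strictly convex if its boundary contains no arc (joining two different,
non-antipodal points). -/
def IsStrictlyConvex (C : Set S2) : Prop :=
  ∀ a b : S2, a ≠ b → a ≠ -b → ¬ arc a b ⊆ frontier C

/-- The hemisphere with center `m`. -/
def hemisphere (m : S2) : Set S2 := {x | sdist m x ≤ Real.pi / 2}

/-- The great circle bounding the hemisphere with center `m`. -/
def greatCircle (m : S2) : Set S2 := {x | sdist m x = Real.pi / 2}

/-- The hemisphere with center `m` supports `C` at the boundary point `p`. -/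
def SupportsAt (m : S2) (C : Set S2) (p : S2) : Prop :=
  p ∈ frontier C ∧ C ⊆ hemisphere m ∧ p ∈ greatCircle m

/-- The hemisphere with center `m` supports `C`. -/
def Supports (m : S2) (C : Set S2) : Prop := ∃ p, SupportsAt m C p

/-- `S` is the semicircle with center `c` : the points of a great circle through `c` in distance
at most `π / 2` from `c`. -/
def IsSemicircle (S : Set S2) (c : S2) : Prop :=
  ∃ m : S2, c ∈ greatCircle m ∧ S = {x | x ∈ greatCircle m ∧ sdist c x ≤ Real.pi / 2}

/-- The semicircle `G/H` bounding the lune `G ∩ H`, where `G` and `H` are the hemispheres with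
centers `g` and `h` : the part in `H` of the great circle bounding `G`. -/
def lunePart (g h : S2) : Set S2 := greatCircle g ∩ hemisphere h

/-- The hemispheres with centers `g` and `h` are different and not opposite, and the lune
which is their intersection has thickness `t` : the distance of the centers of the two
semicircles bounding it. -/
def HasLuneThickness (g h : S2) (t : ℝ) : Prop :=
  g ≠ h ∧ g ≠ -h ∧
    ∃ c c' : S2, IsSemicircle (lunePart g h) c ∧ IsSemicircle (lunePart h g) c' ∧ sdist c c' = t

/-- The width of `C` determined by the hemisphere with center `k` is `w` : the minimum of the
thicknesses of the lunes `K ∩ K'` over hemispheres `K'` supporting `C`. -/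
def HasWidth (C : Set S2) (k : S2) (w : ℝ) : Prop :=
  IsLeast {t | ∃ k' : S2, Supports k' C ∧ HasLuneThickness k k' t} w

/-- `C` is of constant width `w` : every hemisphere supporting `C` determines the width `w`. -/
def HasConstantWidth (C : Set S2) (w : ℝ) : Prop :=
  ∀ k : S2, Supports k C → HasWidth C k w

end SphericalGeometry

end

open scoped RealInnerProductSpace

namespace SphericalGeometry

/-! ### Polarity: the cone dual to the body, in any real inner product space. -/

section DualCone

variable {E : Type*} [NormedAddCommGroup E] [InnerProductSpace ℝ E]

/-! Pass to the polar body: the centers of supporting hemispheres are the unit vectors on the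
boundary of the dual cone. A lune with centers `g`, `h` has thickness `π` minus their distance
(`HasLuneThickness.cos_eq`), so constant width `w` says that every polar boundary point has a
farthest polar boundary point, always at distance `π - w`. This exceeds a right angle because `w < π
/ 2`; put `γ = cos w > 0`.

An arc in the boundary of `W` would yield a center `k` orthogonal to two points `a ≠ b` of `W`, a
corner of the polar body. At a pair `k, k'` in maximal distance, `k' + γ • k` is an inner normal of
the polar body at `k` (`inner_add_smul_nonneg`). Approaching the corner from its two sides, the
normals stay apart, hence so do the farthest points (`exists_mem_dualCone_leaning`). This gives two
separated polar points almost farthest from `k`. Their midpoint direction is then too far from `k`,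
since distances beyond a right angle grow towards the middle of an arc (`eq_of_inner_eq_zero`). -/

/-- The cone of the vectors which have non-negative inner products with all points of `W`. -/
def dualCone (W : Set E) : Set E := {y | ∀ x ∈ W, 0 ≤ ⟪y, x⟫}

/-- The unit vectors on the boundary of the dual cone of `W`: the centers of the hemispheres
supporting `W`. -/
def dualBoundary (W : Set E) : Set E :=
  {k | ‖k‖ = 1 ∧ k ∈ dualCone W ∧ ∃ p ∈ W, ⟪k, p⟫ = 0}

theorem add_mem_dualCone {W : Set E} {x y : E} (hx : x ∈ dualCone W) (hy : y ∈ dualCone W) :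
    x + y ∈ dualCone W := fun z hz => by
  rw [inner_add_left]; exact add_nonneg (hx z hz) (hy z hz)

theorem smul_mem_dualCone {W : Set E} {x : E} (hx : x ∈ dualCone W) {t : ℝ} (ht : 0 ≤ t) :
    t • x ∈ dualCone W := fun z hz => by
  rw [real_inner_smul_left]; exact mul_nonneg ht (hx z hz)

theorem isClosed_dualCone (W : Set E) : IsClosed (dualCone W) := by
  have : dualCone W = ⋂ x ∈ W, {y : E | 0 ≤ ⟪y, x⟫} := by ext; simp [dualCone]
  rw [this]
  exact isClosed_biInter fun x _ => isClosed_le continuous_const (by fun_prop)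

theorem inner_normalize_left (y x : E) : ⟪‖y‖⁻¹ • y, x⟫ = ⟪y, x⟫ / ‖y‖ := by
  rw [real_inner_smul_left]; ring

theorem norm_normalize {y : E} (hy : y ≠ 0) : ‖‖y‖⁻¹ • y‖ = 1 := by
  rw [norm_smul, norm_inv, norm_norm, inv_mul_cancel₀ (norm_ne_zero_iff.2 hy)]

/-- The normalization of a non-zero vector of the dual cone orthogonal to a point of `W`. -/
theorem normalize_mem_dualBoundary {W : Set E} {y p : E} (hy : y ∈ dualCone W) (h0 : y ≠ 0)
    (hp : p ∈ W) (hyp : ⟪y, p⟫ = 0) : ‖y‖⁻¹ • y ∈ dualBoundary W :=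
  ⟨norm_normalize h0, smul_mem_dualCone hy (by positivity), p, hp, by
    rw [inner_normalize_left, hyp, zero_div]⟩

/-- A ray leaving the dual cone has a last point in it, orthogonal to a point of `W`. -/
theorem exists_last_mem_dualCone {W : Set E} (hW : IsCompact W) (hW1 : ∀ x ∈ W, ‖x‖ = 1)
    {y v x₀ : E} (hx₀ : x₀ ∈ W) (hv : 0 < ⟪v, x₀⟫) {t₀ : ℝ} (ht₀ : y - t₀ • v ∈ dualCone W) :
    ∃ t, t₀ ≤ t ∧ y - t • v ∈ dualCone W ∧ ∃ p ∈ W, ⟪y - t • v, p⟫ = 0 := by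
  set S : Set ℝ := {t | y - t • v ∈ dualCone W} with hS
  have hSc : IsClosed S := (isClosed_dualCone W).preimage (by fun_prop)
  have hSb : BddAbove S := ⟨⟪y, x₀⟫ / ⟪v, x₀⟫, fun t ht => by
    have := ht x₀ hx₀
    rw [inner_sub_left, real_inner_smul_left] at this
    rw [le_div_iff₀ hv]; linarith⟩
  have hmem : sSup S ∈ S := hSc.csSup_mem ⟨t₀, ht₀⟩ hSb
  refine ⟨sSup S, le_csSup hSb ht₀, hmem, ?_⟩
  -- Otherwise compactness gives a positive minimum of the inner products over `W`, which leaves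
  -- room to move further along the ray.
  by_contra! hne
  obtain ⟨p, hp, hmin⟩ := hW.exists_isMinOn ⟨x₀, hx₀⟩
    (f := fun x => ⟪y - sSup S • v, x⟫) (by fun_prop)
  have hpos : 0 < ⟪y - sSup S • v, p⟫ := lt_of_le_of_ne (hmem p hp) (hne p hp).symm
  set η := ⟪y - sSup S • v, p⟫ with hη
  have hε : 0 < η / (‖v‖ + 1) := by positivity
  have hlt : sSup S + η / (‖v‖ + 1) ∈ S := fun x hx => by
    have h1 : η ≤ ⟪y - sSup S • v, x⟫ := hmin hx
    have h2 : ⟪v, x⟫ ≤ ‖v‖ := by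
      simpa [hW1 x hx] using real_inner_le_norm v x
    rw [add_smul, ← sub_sub, inner_sub_left (y - _), real_inner_smul_left]
    have h3 : η / (‖v‖ + 1) * ⟪v, x⟫ ≤ η / (‖v‖ + 1) * (‖v‖ + 1) :=
      mul_le_mul_of_nonneg_left (by linarith) hε.le
    rw [div_mul_cancel₀ _ (by positivity)] at h3
    linarith
  linarith [le_csSup hSb hlt]

/-! ### Polar bodies of constant diameter greater than a right angle are smooth. -/

section ConstantDiameter

variable {W : Set E} {γ : ℝ} (hW : IsCompact W) (hW1 : ∀ x ∈ W, ‖x‖ = 1)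
  (hpt : ∀ y ∈ dualCone W, y ≠ 0 → ∃ x ∈ W, 0 < ⟪y, x⟫) (hγ : 0 < γ)
  (hdiam : ∀ k ∈ dualBoundary W, ∀ k' ∈ dualBoundary W, k ≠ k' → k ≠ -k' → -γ ≤ ⟪k, k'⟫)

include hW hW1 hpt hγ hdiam

/-- A bound for the distances between boundary points of the dual cone which exceeds a right
angle is a bound for the distances of boundary points to all points. -/
theorem neg_mul_norm_le_inner {k y : E} (hk : k ∈ dualBoundary W) (hy : y ∈ dualCone W) :
    -γ * ‖y‖ ≤ ⟪k, y⟫ := by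
  by_contra! hlt
  have hk0 : k ≠ 0 := norm_ne_zero_iff.1 (by rw [hk.1]; norm_num)
  obtain ⟨x₀, hx₀, hkx₀⟩ := hpt k hk.2.1 hk0
  -- Moving `y` in direction `-k` only increases its angle with `k`, so the exit point is a boundary
  -- point violating `hdiam`.
  obtain ⟨t, ht, hz, p, hp, hzp⟩ := exists_last_mem_dualCone hW hW1 (y := y) (v := k) hx₀ hkx₀
    (t₀ := 0) (by simpa using hy)
  set z := y - t • k with hzdef
  have hkz : ⟪k, z⟫ = ⟪k, y⟫ - t := by
    rw [hzdef, inner_sub_right, real_inner_smul_right, real_inner_self_eq_norm_sq, hk.1]; ring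
  have hy0 : 0 ≤ γ * ‖y‖ := by positivity
  have hkz0 : ⟪k, z⟫ < 0 := by rw [hkz]; linarith
  have hz0 : z ≠ 0 := by rintro h; rw [h, inner_zero_right] at hkz0; exact lt_irrefl _ hkz0
  have hzn : 0 < ‖z‖ := norm_pos_iff.2 hz0
  have hB := normalize_mem_dualBoundary hz hz0 hp hzp
  have hin : ⟪k, ‖z‖⁻¹ • z⟫ = ⟪k, z⟫ / ‖z‖ := by rw [real_inner_smul_right]; ring
  have hle := hdiam k hk _ hB
    (fun h => by
      have h1 : ⟪k, ‖z‖⁻¹ • z⟫ = 1 := by rw [← h, real_inner_self_eq_norm_sq, hk.1]; norm_num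
      have h2 : ⟪k, z⟫ / ‖z‖ < 0 := div_neg_of_neg_of_pos hkz0 hzn
      linarith)
    (fun h => by
      have h1 := hB.2.1 x₀ hx₀
      rw [h, inner_neg_left] at hkx₀
      linarith)
  rw [hin, le_div_iff₀ hzn, hkz] at hle
  have hz2 : ‖z‖ ^ 2 = ‖y‖ ^ 2 - 2 * t * ⟪k, y⟫ + t ^ 2 := by
    rw [hzdef, norm_sub_sq_real, real_inner_smul_right, norm_smul, hk.1, real_inner_comm,
      mul_one, Real.norm_eq_abs, sq_abs]
    ring
  have hcs : ⟪k, y⟫ ^ 2 ≤ ‖y‖ ^ 2 := by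
    have := abs_real_inner_le_norm k y
    rw [hk.1, one_mul] at this
    exact sq_le_sq' (by linarith [neg_abs_le ⟪k, y⟫]) (by linarith [le_abs_self ⟪k, y⟫])
  have hyn : 0 < ‖y‖ := by
    by_contra! h
    have h0 : ‖y‖ = 0 := le_antisymm h (norm_nonneg _)
    have : ⟪k, y⟫ = 0 := by rw [norm_eq_zero.1 h0, inner_zero_right]
    rw [h0, this] at hlt; simp at hlt
  -- compare the squares of the two sides of `hle`, multiplied by `‖y‖`
  have h1 : -⟪k, y⟫ * ‖z‖ ≤ (t - ⟪k, y⟫) * ‖y‖ := by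
    apply le_of_sq_le_sq _ (mul_nonneg (by linarith) hyn.le)
    rw [mul_pow, mul_pow, hz2]
    nlinarith [mul_nonneg (sub_nonneg.2 hcs)
      (add_nonneg (sq_nonneg t) (mul_nonneg ht (by linarith : 0 ≤ -(2 * ⟪k, y⟫))))]
  have h2 : (t - ⟪k, y⟫) * ‖y‖ ≤ γ * ‖z‖ * ‖y‖ :=
    mul_le_mul_of_nonneg_right (by linarith) hyn.le
  have h3 : γ * ‖y‖ * ‖z‖ < -⟪k, y⟫ * ‖z‖ := mul_lt_mul_of_pos_right (by linarith) hzn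
  linarith

/-- For boundary points of the dual cone in maximal distance, the great circle through the first
one orthogonal to the arc joining them supports the dual cone. -/
theorem inner_add_smul_nonneg {k k' x : E} (hk : k ∈ dualBoundary W) (hk' : k' ∈ dualBoundary W)
    (hkk' : ⟪k, k'⟫ = -γ) (hx : x ∈ dualCone W) : 0 ≤ ⟪x, k' + γ • k⟫ := by
  rw [inner_add_right, real_inner_smul_right]
  by_contra! hneg
  set d := -(⟪x, k'⟫ + γ * ⟪x, k⟫) with hd
  have hd0 : 0 < d := by linarith
  set X := ‖x‖ ^ 2 with hX
  have hX0 : 0 ≤ X := by positivity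
  -- First variation: `k + τ • x` stays in the cone, so its distance from `k'` is bounded. Expanding
  -- the norm to first order in `τ` leaves an error of order `τ ^ 2`.
  have key : ∀ τ : ℝ, 0 < τ → d ≤ γ * X * τ / 2 := fun τ hτ => by
    have h1 := neg_mul_norm_le_inner hW hW1 hpt hγ hdiam hk'
      (add_mem_dualCone hk.2.1 (smul_mem_dualCone hx hτ.le))
    have h2 : ‖k + τ • x‖ ^ 2 = 1 + 2 * τ * ⟪x, k⟫ + τ ^ 2 * X := by
      rw [norm_add_sq_real, real_inner_smul_right, norm_smul, hk.1, real_inner_comm,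
        Real.norm_eq_abs, mul_pow, sq_abs]
      ring
    rw [inner_add_right, real_inner_smul_right, real_inner_comm, hkk', real_inner_comm] at h1
    have h3 : ‖k + τ • x‖ ≤ 1 + τ * ⟪x, k⟫ + τ ^ 2 * X / 2 := by
      nlinarith [sq_nonneg (‖k + τ • x‖ - 1)]
    have h4 := mul_le_mul_of_nonneg_left h3 hγ.le
    have h5 : τ * d ≤ τ * (γ * X * τ / 2) := by rw [hd]; linarith
    exact le_of_mul_le_mul_left h5 hτ
  have h := key (d / (γ * X + 1)) (by positivity)
  have h0 : 0 ≤ γ * X := by positivity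
  have h' : γ * X * (d / (γ * X + 1)) ≤ d := by
    rw [← mul_div_assoc, div_le_iff₀ (by positivity)]; nlinarith
  linarith

variable (hγ1 : γ < 1)
  (hattain : ∀ k ∈ dualBoundary W, ∃ k' ∈ dualBoundary W, ⟪k, k'⟫ = -γ)

include hγ1 hattain

/-- Near a boundary point `k` of the dual cone orthogonal to two points `a` and `b` of `W`, there
are boundary points whose points in maximal distance lean to the side of `a`. -/
theorem exists_mem_dualCone_leaning {q : E} {r : ℝ} (hr : 0 < r) (hq : ∀ x ∈ W, r ≤ ⟪q, x⟫)
    {k a b : E} (hk : k ∈ dualBoundary W) (ha : a ∈ W) (hb : b ∈ W) (hab : a ≠ b)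
    (hka : ⟪k, a⟫ = 0) (hkb : ⟪k, b⟫ = 0) :
    ∃ η > 0, ∀ δ > 0, ∃ m ∈ dualCone W, ‖m‖ = 1 ∧ ⟪k, m⟫ ≤ -γ + δ ∧ ⟪b - a, m⟫ ≤ -η := by
  set c := b - a with hc
  have hca : ⟪c, a⟫ < 0 := by
    have h1 : ‖c‖ ^ 2 = 2 - 2 * ⟪b, a⟫ := by
      rw [hc, norm_sub_sq_real, hW1 a ha, hW1 b hb]; ring
    have h2 : 0 < ‖c‖ ^ 2 := by
      have : c ≠ 0 := sub_ne_zero.2 hab.symm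
      positivity
    rw [hc, inner_sub_left, real_inner_self_eq_norm_sq, hW1 a ha]
    linarith
  have hkc : ⟪c, k⟫ = 0 := by
    rw [hc, inner_sub_left, real_inner_comm, hkb, real_inner_comm, hka, sub_zero]
  clear_value c
  have hqa : 0 < ⟪q, a⟫ := hr.trans_le (hq a ha)
  set M := ‖c‖ + ‖c‖ / r * ‖q‖ with hM
  have hM0 : 0 ≤ M := by positivity
  -- Independent of the perturbation `ε` below: the slope of the bound `hta` on `t`, times the lower
  -- bound `hqn` for the inner product of `q` with the normal.
  set η := -(⟪c, a⟫ / ⟪q, a⟫ * (r * (1 - γ ^ 2))) with hη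
  have hγ2 : 0 < 1 - γ ^ 2 := by nlinarith
  have hη0 : 0 < η := by
    rw [hη]
    have : ⟪c, a⟫ / ⟪q, a⟫ < 0 := div_neg_of_neg_of_pos hca hqa
    have h' : 0 < r * (1 - γ ^ 2) := by positivity
    nlinarith
  have main : ∀ ε > 0, ε * M ≤ 1 / 2 → ∃ m ∈ dualCone W, ‖m‖ = 1 ∧
      ⟪k, m⟫ ≤ -γ + 2 * (ε * M) ∧ ⟪c, m⟫ ≤ -η + 2 * ‖c‖ * (ε * M) := by
    intro ε hε hεM
    -- The point `k + ε • c` violates the constraint of `a`, so a multiple of the interior direction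
    -- `q` must be added to return to the cone. The starting value `t₀` adds enough of it to satisfy
    -- all constraints.
    obtain ⟨t, ht, hy, p, hp, hyp⟩ := exists_last_mem_dualCone hW hW1 (y := k + ε • c) (v := q)
      ha hqa (t₀ := -(ε * (‖c‖ / r))) (fun x hx => by
        rw [neg_smul, sub_neg_eq_add, inner_add_left, inner_add_left, real_inner_smul_left,
          real_inner_smul_left]
        have h1 := hk.2.1 x hx
        have h2 : -‖c‖ ≤ ⟪c, x⟫ := by
          have := abs_real_inner_le_norm c x
          rw [hW1 x hx, mul_one] at this
          linarith [neg_abs_le ⟪c, x⟫]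
        have h3 : ‖c‖ / r * r ≤ ‖c‖ / r * ⟪q, x⟫ :=
          mul_le_mul_of_nonneg_left (hq x hx) (by positivity)
        rw [div_mul_cancel₀ _ hr.ne'] at h3
        nlinarith)
    set y := k + ε • c - t • q with hydef
    have hta : t ≤ ε * (⟪c, a⟫ / ⟪q, a⟫) := by
      have := hy a ha
      rw [hydef, inner_sub_left, inner_add_left, real_inner_smul_left, real_inner_smul_left,
        hka] at this
      rw [← mul_div_assoc, le_div_iff₀ hqa]; linarith
    have ht0 : t < 0 := by
      have : ⟪c, a⟫ / ⟪q, a⟫ < 0 := div_neg_of_neg_of_pos hca hqa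
      nlinarith
    have hyk : ‖y - k‖ ≤ ε * M := by
      have h1 : y - k = ε • c - t • q := by rw [hydef]; abel
      have h2 : ‖t • q‖ ≤ ε * (‖c‖ / r) * ‖q‖ := by
        rw [norm_smul, Real.norm_eq_abs, abs_of_neg ht0]
        exact mul_le_mul_of_nonneg_right (by linarith) (norm_nonneg _)
      have h3 : ‖ε • c‖ = ε * ‖c‖ := by rw [norm_smul, Real.norm_eq_abs, abs_of_pos hε]
      rw [h1]
      refine (norm_sub_le _ _).trans ?_
      rw [h3, hM]; linarith
    have hyx : ∀ x, ⟪y, x⟫ = ⟪k, x⟫ + ε * ⟪c, x⟫ - t * ⟪q, x⟫ := fun x => by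
      rw [hydef, inner_sub_left, inner_add_left, real_inner_smul_left, real_inner_smul_left]
    clear_value y
    have hyn : 1 - ε * M ≤ ‖y‖ := by
      have := norm_sub_norm_le k y
      rw [hk.1, norm_sub_rev k y] at this
      linarith
    have hyn0 : 0 < ‖y‖ := by linarith
    have hκ := normalize_mem_dualBoundary hy (norm_pos_iff.1 hyn0) hp hyp
    set κ := ‖y‖⁻¹ • y with hκdef
    obtain ⟨m, hm, hκm⟩ := hattain κ hκ
    have hym : ⟪y, m⟫ = -γ * ‖y‖ := by
      rw [hκdef, inner_normalize_left, div_eq_iff hyn0.ne'] at hκm; exact hκm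
    have hbi := fun x hx =>
      inner_add_smul_nonneg hW hW1 hpt hγ hdiam (x := x) hκ hm hκm hx
    set n := m + γ • κ with hn
    have hn2 : ‖n‖ ^ 2 = 1 - γ ^ 2 := by
      rw [hn, norm_add_sq_real, real_inner_smul_right, norm_smul, hm.1, hκ.1, real_inner_comm,
        hκm, Real.norm_eq_abs, abs_of_pos hγ]
      ring
    have hn1 : ‖n‖ ≤ 1 := by nlinarith [norm_nonneg n]
    -- As `‖n‖ ≤ 1`, the vector `q - r • n` is still in the dual cone, and the normal `n` can be
    -- tested on it.
    have hqn : r * (1 - γ ^ 2) ≤ ⟪q, n⟫ := by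
      have := hbi (q - r • n) (fun x hx => by
        rw [inner_sub_left, real_inner_smul_left]
        have h1 := hq x hx
        have h2 := real_inner_le_norm n x
        rw [hW1 x hx, mul_one] at h2
        nlinarith)
      rw [inner_sub_left, real_inner_smul_left, real_inner_self_eq_norm_sq, hn2] at this
      linarith
    have hyn' : ⟪y, n⟫ = 0 := by
      rw [hn, inner_add_right, hym, real_inner_smul_right, hκdef, real_inner_smul_right,
        real_inner_self_eq_norm_sq]
      field_simp; ring
    have hkn := hbi k hk.2.1
    -- Expand `⟪y, n⟫ = 0`: the term with `k` is non-negative and the term with `q` is bounded below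
    -- by a multiple of `ε`, so `c` must compensate.
    have hcn : ⟪c, n⟫ ≤ -η := by
      have h1 : ⟪k, n⟫ + ε * ⟪c, n⟫ - t * ⟪q, n⟫ = 0 := by
        rw [← hyn', hyx]
      have h2 : t * ⟪q, n⟫ ≤ t * (r * (1 - γ ^ 2)) := mul_le_mul_of_nonpos_left hqn ht0.le
      have h3 : t * (r * (1 - γ ^ 2)) ≤ ε * (⟪c, a⟫ / ⟪q, a⟫) * (r * (1 - γ ^ 2)) :=
        mul_le_mul_of_nonneg_right hta (by positivity)
      have h4 : ε * ⟪c, n⟫ ≤ ε * (-η) := by rw [hη]; linarith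
      exact le_of_mul_le_mul_left h4 hε
    refine ⟨m, hm.2.1, hm.1, ?_, ?_⟩
    · have h1 : ⟪k, m⟫ = ⟪y, m⟫ - ⟪y - k, m⟫ := by rw [inner_sub_left]; ring
      have h2 := abs_real_inner_le_norm (y - k) m
      rw [hm.1, mul_one] at h2
      have h3 := neg_abs_le ⟪y - k, m⟫
      have h4 : γ * (1 - ‖y‖) ≤ γ * (ε * M) := mul_le_mul_of_nonneg_left (by linarith) hγ.le
      have h5 : γ * (ε * M) ≤ 1 * (ε * M) := mul_le_mul_of_nonneg_right hγ1.le (by positivity)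
      rw [h1, hym]
      linarith
    -- Since `c` is orthogonal to `k` and `y` is close to `k`, replacing `n` by `m` costs only a
    -- term of order `ε`.
    · have h1 : ⟪c, m⟫ = ⟪c, n⟫ - γ * (⟪c, y - k⟫ / ‖y‖) := by
        rw [hn, inner_add_right, real_inner_smul_right, hκdef, real_inner_smul_right,
          inner_sub_right, hkc]
        ring
      have h2 := abs_real_inner_le_norm c (y - k)
      have h3 := neg_abs_le ⟪c, y - k⟫
      have h4 : ‖c‖ * ‖y - k‖ ≤ ‖c‖ * (ε * M) := mul_le_mul_of_nonneg_left hyk (norm_nonneg _)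
      have h0 : 0 ≤ ‖c‖ * (ε * M) := by positivity
      have h5 : -(2 * ‖c‖ * (ε * M)) ≤ ⟪c, y - k⟫ / ‖y‖ := by
        rw [le_div_iff₀ hyn0]
        have := mul_le_mul_of_nonneg_left (by linarith : 1 / 2 ≤ ‖y‖) h0
        linarith
      have h6 : -(2 * ‖c‖ * (ε * M)) ≤ γ * (⟪c, y - k⟫ / ‖y‖) := by
        have h7 := mul_le_mul_of_nonneg_left h5 hγ.le
        have h8 := mul_le_mul_of_nonneg_right hγ1.le h0
        linarith
      rw [h1]; linarith
  refine ⟨η / 2, by positivity, fun δ hδ => ?_⟩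
  set e := min (1 / 2) (min (δ / 2) (η / 2 / (2 * ‖c‖ + 1))) with he
  have he0 : 0 < e := by rw [he]; positivity
  have h1 : e / (M + 1) * M ≤ e := by
    rw [div_mul_eq_mul_div, div_le_iff₀ (by positivity)]; nlinarith
  have he1 : e ≤ 1 / 2 := min_le_left _ _
  have he2 : e ≤ δ / 2 := (min_le_right _ _).trans (min_le_left _ _)
  have he3 : e ≤ η / 2 / (2 * ‖c‖ + 1) := (min_le_right _ _).trans (min_le_right _ _)
  rw [le_div_iff₀ (by positivity)] at he3
  obtain ⟨m, hm, hm1, hkm, hcm⟩ := main (e / (M + 1)) (by positivity) (by linarith)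
  refine ⟨m, hm, hm1, by linarith, hcm.trans ?_⟩
  have := mul_le_mul_of_nonneg_left h1 (by positivity : 0 ≤ 2 * ‖c‖)
  linarith

/-- If all boundary points of the dual cone have the same farthest distance, which exceeds a
right angle, then each of them is orthogonal to one point of `W` only. -/
theorem eq_of_inner_eq_zero {q : E} {r : ℝ} (hr : 0 < r) (hq : ∀ x ∈ W, r ≤ ⟪q, x⟫)
    {k a b : E} (hk : k ∈ dualBoundary W) (ha : a ∈ W) (hb : b ∈ W)
    (hka : ⟪k, a⟫ = 0) (hkb : ⟪k, b⟫ = 0) : a = b := by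
  by_contra hab
  obtain ⟨η₁, hη₁, H₁⟩ := exists_mem_dualCone_leaning hW hW1 hpt hγ hdiam hγ1 hattain hr hq
    hk ha hb hab hka hkb
  obtain ⟨η₂, hη₂, H₂⟩ := exists_mem_dualCone_leaning hW hW1 hpt hγ hdiam hγ1 hattain hr hq
    hk hb ha (Ne.symm hab) hkb hka
  set c := b - a with hc
  have hc0 : 0 < ‖c‖ := norm_pos_iff.2 (sub_ne_zero.2 (Ne.symm hab))
  set d := (η₁ + η₂) / ‖c‖ with hd
  have hd0 : 0 < d := by positivity
  obtain ⟨m₁, hm₁, hn₁, hk₁, hc₁⟩ := H₁ (γ * d ^ 2 / 16) (by positivity)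
  obtain ⟨m₂, hm₂, hn₂, hk₂, hc₂⟩ := H₂ (γ * d ^ 2 / 16) (by positivity)
  rw [← neg_sub, ← hc, inner_neg_left] at hc₂
  have h1 : d ≤ ‖m₂ - m₁‖ := by
    rw [hd, div_le_iff₀ hc0]
    have := real_inner_le_norm c (m₂ - m₁)
    rw [inner_sub_right] at this
    linarith
  -- The sum `m₂ + m₁` must have norm at least `2 - d ^ 2 / 8`, whereas the parallelogram law bounds
  -- its square by `4 - d ^ 2`.
  have h2 := neg_mul_norm_le_inner hW hW1 hpt hγ hdiam hk (add_mem_dualCone hm₂ hm₁)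
  rw [inner_add_right] at h2
  have h3 : γ * (2 - d ^ 2 / 8) ≤ γ * ‖m₂ + m₁‖ := by linarith
  have h4 := le_of_mul_le_mul_left h3 hγ
  have h5 := parallelogram_law_with_norm ℝ m₂ m₁
  rw [hn₁, hn₂] at h5
  have h6 : d ^ 2 ≤ ‖m₂ - m₁‖ ^ 2 := pow_le_pow_left₀ hd0.le h1 2
  have h7 : (2 - d ^ 2 / 8) ^ 2 ≤ ‖m₂ + m₁‖ ^ 2 :=
    pow_le_pow_left₀ (by linarith [sq_nonneg ‖m₂ + m₁‖]) h4 2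
  have h8 : 0 < d ^ 2 := by positivity
  nlinarith [sq_nonneg (d ^ 2)]

end ConstantDiameter

end DualCone

end SphericalGeometry

namespace SphericalGeometry

-- The sphere and its hemispheres in terms of inner products.

local notation "E3" => EuclideanSpace ℝ (Fin 3)

theorem S2.norm_eq_one (x : S2) : ‖(x : E3)‖ = 1 := norm_eq_of_mem_sphere x

theorem S2.coe_neg (x : S2) : ((-x : S2) : E3) = -(x : E3) := rfl

theorem S2.ne_zero (x : S2) : (x : E3) ≠ 0 := ne_zero_of_mem_unit_sphere x

/-- The unit vector in the direction of a non-zero vector as a point of the sphere. -/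
noncomputable def toS2 (v : E3) (hv : v ≠ 0) : S2 :=
  ⟨‖v‖⁻¹ • v, by rw [mem_sphere_zero_iff_norm]; exact norm_normalize hv⟩

theorem coe_toS2 (v : E3) (hv : v ≠ 0) : (toS2 v hv : E3) = ‖v‖⁻¹ • v := rfl

theorem norm_smul_toS2 (v : E3) (hv : v ≠ 0) : ‖v‖ • (toS2 v hv : E3) = v := by
  rw [coe_toS2, smul_smul, mul_inv_cancel₀ (norm_ne_zero_iff.2 hv), one_smul]

theorem inner_toS2 (x v : E3) (hv : v ≠ 0) : ⟪x, (toS2 v hv : E3)⟫ = ⟪x, v⟫ / ‖v‖ := by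
  rw [coe_toS2, real_inner_smul_right]; ring

theorem cos_sdist (a b : S2) : Real.cos (sdist a b) = ⟪(a : E3), (b : E3)⟫ := by
  rw [sdist, InnerProductGeometry.cos_angle, S2.norm_eq_one, S2.norm_eq_one]; simp

theorem sdist_eq_arccos (a b : S2) : sdist a b = Real.arccos ⟪(a : E3), (b : E3)⟫ := by
  rw [sdist, InnerProductGeometry.angle, S2.norm_eq_one, S2.norm_eq_one]; simp

theorem mem_hemisphere_iff {m x : S2} : x ∈ hemisphere m ↔ 0 ≤ ⟪(m : E3), (x : E3)⟫ := by
  rw [hemisphere, Set.mem_ofPred_eq, sdist_eq_arccos, Real.arccos_le_pi_div_two]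

theorem mem_greatCircle_iff {m x : S2} : x ∈ greatCircle m ↔ ⟪(m : E3), (x : E3)⟫ = 0 := by
  rw [greatCircle, Set.mem_ofPred_eq, sdist_eq_arccos, Real.arccos_eq_pi_div_two]

/-! ### Thickness of lunes. -/

section Lune

theorem inner_ne_one {g h : S2} (hne : g ≠ h) : ⟪(g : E3), (h : E3)⟫ ≠ 1 := fun H =>
  hne (Subtype.ext ((inner_eq_one_iff_of_norm_eq_one g.norm_eq_one h.norm_eq_one).1 H))

theorem inner_ne_neg_one {g h : S2} (hne : g ≠ -h) : ⟪(g : E3), (h : E3)⟫ ≠ -1 := fun H =>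
  hne (Subtype.ext ((inner_eq_neg_one_iff_of_norm_eq_one g.norm_eq_one h.norm_eq_one).1 H))

theorem sq_inner_lt_one {g h : S2} (hne : g ≠ h) (hne' : g ≠ -h) :
    ⟪(g : E3), (h : E3)⟫ ^ 2 < 1 := by
  have h1 := abs_real_inner_le_norm (g : E3) (h : E3)
  rw [g.norm_eq_one, h.norm_eq_one, mul_one, abs_le] at h1
  have h2 := lt_of_le_of_ne h1.1 (inner_ne_neg_one hne').symm
  have h3 := lt_of_le_of_ne h1.2 (inner_ne_one hne)
  nlinarith

/-- The component of `h` orthogonal to `g`. -/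
noncomputable def orthComponent (g h : E3) : E3 := h - ⟪g, h⟫ • g

theorem inner_orthComponent_self (g : S2) (h : E3) : ⟪(g : E3), orthComponent g h⟫ = 0 := by
  rw [orthComponent, inner_sub_right, real_inner_smul_right, real_inner_self_eq_norm_sq,
    g.norm_eq_one]
  ring

theorem inner_orthComponent_eq {g h x : E3} (hx : ⟪g, x⟫ = 0) :
    ⟪orthComponent g h, x⟫ = ⟪h, x⟫ := by
  rw [orthComponent, inner_sub_left, real_inner_smul_left, hx]; ring

theorem norm_sq_orthComponent (g h : S2) :
    ‖orthComponent (g : E3) h‖ ^ 2 = 1 - ⟪(g : E3), (h : E3)⟫ ^ 2 := by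
  rw [orthComponent, norm_sub_sq_real, real_inner_smul_right, norm_smul, g.norm_eq_one,
    h.norm_eq_one, real_inner_comm, Real.norm_eq_abs, mul_one, sq_abs]
  ring

theorem orthComponent_ne_zero {g h : S2} (hne : g ≠ h) (hne' : g ≠ -h) :
    orthComponent (g : E3) h ≠ 0 := fun H => by
  have h1 := norm_sq_orthComponent g h
  rw [H, norm_zero] at h1
  linarith [sq_inner_lt_one hne hne']

theorem isSemicircle_lunePart {g h : S2} (hne : g ≠ h) (hne' : g ≠ -h) :
    IsSemicircle (lunePart g h) (toS2 _ (orthComponent_ne_zero hne hne')) := by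
  have h0 := orthComponent_ne_zero hne hne'
  refine ⟨g, ?_, ?_⟩
  · rw [mem_greatCircle_iff, inner_toS2, inner_orthComponent_self, zero_div]
  · ext x
    refine and_congr_right fun hx => ?_
    rw [mem_greatCircle_iff] at hx
    change x ∈ hemisphere h ↔ x ∈ hemisphere (toS2 _ h0)
    rw [mem_hemisphere_iff, mem_hemisphere_iff, coe_toS2, inner_normalize_left,
      inner_orthComponent_eq hx]
    have : 0 < ‖orthComponent (g : E3) h‖ := norm_pos_iff.2 h0
    exact ⟨fun H => div_nonneg H this.le, fun H => by
      have := mul_nonneg H this.le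
      rwa [div_mul_cancel₀ _ (by positivity)] at this⟩

/-- The center of a semicircle bounding a lune is unique. -/
theorem eq_of_isSemicircle_lunePart {g h c : S2} (hne : g ≠ h) (hne' : g ≠ -h)
    (hc : IsSemicircle (lunePart g h) c) : c = toS2 _ (orthComponent_ne_zero hne hne') := by
  obtain ⟨m, hcm, hS⟩ := hc
  have h0 := orthComponent_ne_zero hne hne'
  set d := toS2 _ h0 with hd
  have hmem : ∀ x : S2, (⟪(g : E3), (x : E3)⟫ = 0 ∧ 0 ≤ ⟪(h : E3), (x : E3)⟫) ↔
      (⟪(m : E3), (x : E3)⟫ = 0 ∧ 0 ≤ ⟪(c : E3), (x : E3)⟫) := fun x => by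
    have := Set.ext_iff.1 hS x
    rw [lunePart, Set.mem_inter_iff, mem_greatCircle_iff, mem_hemisphere_iff] at this
    rw [this, ← mem_greatCircle_iff, ← mem_hemisphere_iff]
    rfl
  rw [mem_greatCircle_iff] at hcm
  have hgd : ⟪(g : E3), (d : E3)⟫ = 0 := by
    rw [hd, inner_toS2, inner_orthComponent_self, zero_div]
  have hds : ∀ x : E3, ⟪(g : E3), x⟫ = 0 → ⟪(h : E3), x⟫ = 0 → ⟪(d : E3), x⟫ = 0 := fun x hg hh => by
    rw [hd, coe_toS2, inner_normalize_left, inner_orthComponent_eq hg, hh, zero_div]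
  have hhd : 0 ≤ ⟪(h : E3), (d : E3)⟫ := by
    rw [hd, inner_toS2, ← inner_orthComponent_eq (inner_orthComponent_self g h),
      real_inner_self_eq_norm_sq]
    positivity
  obtain ⟨hmd, hcd⟩ := (hmem d).1 ⟨hgd, hhd⟩
  -- the part of `d` orthogonal to `c` is an endpoint of the semicircle up to scaling
  set y := orthComponent (c : E3) d with hy
  have hcy : ⟪(c : E3), y⟫ = 0 := inner_orthComponent_self c d
  have hmy : ⟪(m : E3), y⟫ = 0 := by
    rw [hy, orthComponent, inner_sub_right, real_inner_smul_right, hmd, hcm]; ring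
  by_contra hcd'
  by_cases hcd'' : c = -d
  · rw [hcd''] at hcd
    rw [S2.coe_neg, inner_neg_left, real_inner_self_eq_norm_sq,
      d.norm_eq_one] at hcd
    norm_num at hcd
  have hy0 : y ≠ 0 := orthComponent_ne_zero hcd' hcd''
  have hyn : 0 < ‖y‖ := norm_pos_iff.2 hy0
  obtain ⟨hgy, hhy⟩ := (hmem (toS2 y hy0)).2
    ⟨by rw [inner_toS2, hmy, zero_div], by rw [inner_toS2, hcy, zero_div]⟩
  obtain ⟨-, hhy'⟩ := (hmem (-(toS2 y hy0))).2
    ⟨by rw [S2.coe_neg, inner_neg_right,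
        inner_toS2, hmy, zero_div, neg_zero],
      by rw [S2.coe_neg, inner_neg_right,
        inner_toS2, hcy, zero_div, neg_zero]⟩
  rw [S2.coe_neg, inner_neg_right] at hhy'
  have hdy := hds _ hgy (by linarith)
  rw [inner_toS2, div_eq_zero_iff, or_iff_left hyn.ne', hy, orthComponent, inner_sub_right,
    real_inner_smul_right, real_inner_self_eq_norm_sq, d.norm_eq_one, real_inner_comm] at hdy
  have hlt := sq_inner_lt_one hcd' hcd''
  rw [real_inner_comm] at hlt
  linarith

/-- With `s = ⟪g, h⟫`, both orthogonal components have squared norm `1 - s ^ 2`, and their inner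
product is `-s * (1 - s ^ 2)`. -/
theorem cos_sdist_lune_centers {g h : S2} (hne : g ≠ h) (hne' : g ≠ -h) (hne₁ : h ≠ g)
    (hne₁' : h ≠ -g) :
    Real.cos (sdist (toS2 _ (orthComponent_ne_zero hne hne'))
      (toS2 _ (orthComponent_ne_zero hne₁ hne₁'))) = -⟪(g : E3), (h : E3)⟫ := by
  have hs := sq_inner_lt_one hne hne'
  have h1 : ‖orthComponent (h : E3) g‖ = ‖orthComponent (g : E3) h‖ := by
    rw [← sq_eq_sq₀ (norm_nonneg _) (norm_nonneg _), norm_sq_orthComponent,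
      norm_sq_orthComponent, real_inner_comm]
  rw [cos_sdist, inner_toS2, coe_toS2, inner_normalize_left, h1, div_div, ← pow_two,
    norm_sq_orthComponent, div_eq_iff (by linarith)]
  simp only [orthComponent, inner_sub_left, inner_sub_right, real_inner_smul_left,
    real_inner_smul_right, real_inner_self_eq_norm_sq, g.norm_eq_one, h.norm_eq_one]
  rw [real_inner_comm (g : E3) (h : E3)]
  ring

theorem ne_neg_symm {g h : S2} (hne : g ≠ -h) : h ≠ -g := fun H => hne (by rw [H, neg_neg])

theorem exists_hasLuneThickness {g h : S2} (hne : g ≠ h) (hne' : g ≠ -h) :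
    ∃ t, HasLuneThickness g h t :=
  ⟨_, hne, hne', _, _, isSemicircle_lunePart hne hne',
    isSemicircle_lunePart hne.symm (ne_neg_symm hne'), rfl⟩

theorem HasLuneThickness.cos_eq {g h : S2} {t : ℝ} (H : HasLuneThickness g h t) :
    Real.cos t = -⟪(g : E3), (h : E3)⟫ := by
  obtain ⟨hne, hne', c, c', hc, hc', rfl⟩ := H
  rw [eq_of_isSemicircle_lunePart hne hne' hc,
    eq_of_isSemicircle_lunePart hne.symm (ne_neg_symm hne') hc', cos_sdist_lune_centers hne hne' hne.symm (ne_neg_symm hne')]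

theorem HasLuneThickness.mem_Icc {g h : S2} {t : ℝ} (H : HasLuneThickness g h t) :
    t ∈ Set.Icc 0 Real.pi := by
  obtain ⟨-, -, c, c', -, -, rfl⟩ := H
  exact ⟨InnerProductGeometry.angle_nonneg _ _, InnerProductGeometry.angle_le_pi _ _⟩

end Lune

/-! ### Separation theorems for the cone over the body. -/

section Cone

/-- The cone over a subset of the sphere with apex at the origin. -/
def coneOver (W : Set S2) : Set E3 := {v | ∃ x ∈ W, v = ‖v‖ • (x : E3)}

theorem smul_mem_coneOver {W : Set S2} {x : S2} (hx : x ∈ W) {t : ℝ} (ht : 0 ≤ t) :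
    t • (x : E3) ∈ coneOver W :=
  ⟨x, hx, by rw [norm_smul, x.norm_eq_one, Real.norm_of_nonneg ht, mul_one]⟩

theorem coe_mem_coneOver_iff {W : Set S2} {x : S2} : (x : E3) ∈ coneOver W ↔ x ∈ W := by
  refine ⟨fun ⟨y, hy, h⟩ => ?_, fun h => by simpa using smul_mem_coneOver h zero_le_one⟩
  rw [x.norm_eq_one, one_smul] at h
  rwa [Subtype.ext h]

theorem convex_coneOver {W : Set S2} (hW : IsSphConvex W) : Convex ℝ (coneOver W) := by
  rintro u ⟨x, hx, hu⟩ v ⟨y, hy, hv⟩ s t hs ht -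
  by_cases h0 : s • u + t • v = 0
  · rw [h0]; simpa using smul_mem_coneOver hx le_rfl
  refine ⟨toS2 _ h0, hW.2 x hx y hy ?_, (norm_smul_toS2 _ h0).symm⟩
  set z := s • u + t • v with hz
  refine ⟨‖z‖⁻¹ * (s * ‖u‖), ‖z‖⁻¹ * (t * ‖v‖), by positivity, by positivity, ?_⟩
  rw [coe_toS2, mul_smul, mul_smul, mul_smul, mul_smul, ← hu, ← hv, ← smul_add]

/-- The cone is the projection of a closed set along the compact sphere. -/
theorem isClosed_coneOver {W : Set S2} (hW : IsClosed W) : IsClosed (coneOver W) := by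
  have h : IsClosed {q : S2 × E3 | q.1 ∈ W ∧ q.2 = ‖q.2‖ • (q.1 : E3)} :=
    (hW.preimage continuous_fst).inter (isClosed_eq continuous_snd (by fun_prop))
  convert isClosedMap_snd_of_compactSpace _ h using 1
  ext v
  simp [coneOver]

theorem coe_mem_interior_coneOver_iff {W : Set S2} {p : S2} :
    (p : E3) ∈ interior (coneOver W) ↔ p ∈ interior W := by
  constructor
  · intro h
    refine mem_interior.2 ⟨Subtype.val ⁻¹' interior (coneOver W), fun x hx => ?_,
      isOpen_interior.preimage continuous_subtype_val, h⟩
    exact coe_mem_coneOver_iff.1 (interior_subset hx)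
  · intro h
    have hc : ContinuousAt (fun v : E3 => ‖v‖⁻¹ • v) (p : E3) :=
      (continuousAt_id.norm.inv₀ (norm_ne_zero_iff.2 p.ne_zero)).smul continuousAt_id
    obtain ⟨U, hU, hUW⟩ := isOpen_induced_iff.1 (isOpen_interior (s := W))
    have hp : (p : E3) ∈ U := by
      change p ∈ Subtype.val ⁻¹' U; rw [hUW]; exact h
    have hn : (fun v : E3 => ‖v‖⁻¹ • v) (p : E3) = p := by simp [p.norm_eq_one]
    rw [mem_interior_iff_mem_nhds]
    filter_upwards [hc.preimage_mem_nhds (hn.symm ▸ hU.mem_nhds hp),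
      isOpen_ne.mem_nhds p.ne_zero] with v hv hv0
    have hvU : toS2 v hv0 ∈ Subtype.val ⁻¹' U := hv
    rw [hUW] at hvU
    exact ⟨_, interior_subset hvU, (norm_smul_toS2 v hv0).symm⟩

/-- A vector which has non-negative inner products with all points of `W` has positive ones
with the interior points. -/
theorem inner_pos_of_mem_interior {W : Set S2} {y : E3} (hy : y ∈ dualCone (Subtype.val '' W))
    (hy0 : y ≠ 0) {p : S2} (hp : p ∈ interior W) : 0 < ⟪y, (p : E3)⟫ := by
  rw [← coe_mem_interior_coneOver_iff, mem_interior_iff_mem_nhds, Metric.mem_nhds_iff] at hp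
  obtain ⟨ε, hε, hball⟩ := hp
  have hyn : 0 < ‖y‖ := norm_pos_iff.2 hy0
  have hd : 0 < ε / 2 / ‖y‖ := by positivity
  obtain ⟨x, hx, hv⟩ := @hball ((p : E3) - (ε / 2 / ‖y‖) • y) (by
    rw [Metric.mem_ball, dist_eq_norm, sub_sub_cancel_left, norm_neg, norm_smul,
      Real.norm_of_nonneg hd.le, div_mul_cancel₀ _ hyn.ne']
    linarith)
  have h1 : 0 ≤ ⟪y, (p : E3) - (ε / 2 / ‖y‖) • y⟫ := by
    rw [hv, real_inner_smul_right]
    exact mul_nonneg (norm_nonneg _) (hy _ ⟨x, hx, rfl⟩)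
  rw [inner_sub_right, real_inner_smul_right, real_inner_self_eq_norm_sq] at h1
  have : 0 < ε / 2 / ‖y‖ * ‖y‖ ^ 2 := by positivity
  linarith

theorem mem_dualCone_iff {W : Set S2} {k : S2} :
    (k : E3) ∈ dualCone (Subtype.val '' W) ↔ W ⊆ hemisphere k := by
  refine ⟨fun h x hx => mem_hemisphere_iff.2 (h _ ⟨x, hx, rfl⟩), ?_⟩
  rintro h _ ⟨x, hx, rfl⟩
  exact mem_hemisphere_iff.1 (h hx)

theorem mem_dualBoundary_iff_supports {W : Set S2} (hW : IsClosed W) {k : S2} :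
    (k : E3) ∈ dualBoundary (Subtype.val '' W) ↔ Supports k W := by
  constructor
  · rintro ⟨-, hk, _, ⟨p, hp, rfl⟩, hkp⟩
    refine ⟨p, ?_, mem_dualCone_iff.1 hk, mem_greatCircle_iff.2 hkp⟩
    rw [hW.frontier_eq]
    exact ⟨hp, fun h => (inner_pos_of_mem_interior hk k.ne_zero h).ne' hkp⟩
  · rintro ⟨p, hp, hk, hkp⟩
    exact ⟨k.norm_eq_one, mem_dualCone_iff.2 hk, p, ⟨p, hW.frontier_subset hp, rfl⟩,
      mem_greatCircle_iff.1 hkp⟩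

/-- Through every boundary point of a convex body there passes the boundary of a supporting
hemisphere. -/
theorem exists_mem_dualBoundary {W : Set S2} (hW : IsConvexBody W) {p : S2}
    (hp : p ∈ frontier W) :
    ∃ k ∈ dualBoundary (Subtype.val '' W), ⟪k, (p : E3)⟫ = 0 := by
  obtain ⟨hcl, hcv, u, hu⟩ := hW
  have hpW : p ∈ W := hcl.frontier_subset hp
  have hpi : (p : E3) ∉ interior (coneOver W) := by
    rw [coe_mem_interior_coneOver_iff]; exact hp.2
  obtain ⟨f, hf0, hf⟩ := geometric_hahn_banach_of_nonempty_interior_point (convex_coneOver hcv) hpi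
    ⟨u, coe_mem_interior_coneOver_iff.2 hu⟩
  -- On a cone, comparing `f p` with the values at `0` and at `2 • p` forces `f p = 0`.
  have h0 : 0 ≤ f p := by simpa using hf _ (smul_mem_coneOver hpW le_rfl)
  have h2 := hf _ (smul_mem_coneOver hpW zero_le_two)
  rw [map_smul, smul_eq_mul] at h2
  have hfp : f p = 0 := by linarith
  set y : E3 := -(InnerProductSpace.toDual ℝ E3).symm f with hy
  have hyf : ∀ x, ⟪y, x⟫ = -f x := fun x => by
    rw [hy, inner_neg_left, InnerProductSpace.toDual_symm_apply]
  have hyD : y ∈ dualCone (Subtype.val '' W) := by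
    rintro _ ⟨x, hx, rfl⟩
    have := hf _ (coe_mem_coneOver_iff.2 hx)
    rw [hyf]; linarith
  have hy0 : y ≠ 0 := by simpa [hy] using hf0
  have hyp : ⟪y, (p : E3)⟫ = 0 := by rw [hyf, hfp, neg_zero]
  exact ⟨_, normalize_mem_dualBoundary hyD hy0 ⟨p, hpW, rfl⟩ hyp, by
    rw [inner_normalize_left, hyp, zero_div]⟩

/-- A convex body is contained in the interior of a hemisphere. -/
theorem exists_pos_le_inner {W : Set S2} (hcl : IsClosed W) (hcv : IsSphConvex W) :
    ∃ q : E3, ∃ r > 0, ∀ x ∈ Subtype.val '' W, r ≤ ⟪q, x⟫ := by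
  rcases W.eq_empty_or_nonempty with rfl | hne
  · exact ⟨0, 1, one_pos, by simp⟩
  have hpt : ∀ x ∈ W, ∃ y ∈ dualCone (Subtype.val '' W), 0 < ⟪y, (x : E3)⟫ := fun x hx => by
    -- This is where the absence of antipodes enters; separating `-x` from the closed cone gives a
    -- dual vector positive at `x`, and finitely many of these are added up by compactness.
    have hxn : -(x : E3) ∉ coneOver W := fun h =>
      hcv.1 x hx ((coe_mem_coneOver_iff (x := -x)).1 h)
    obtain ⟨f, s, hf, hfx⟩ := geometric_hahn_banach_closed_point (convex_coneOver hcv)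
      (isClosed_coneOver hcl) hxn
    have hs : 0 < s := by simpa using hf _ (smul_mem_coneOver hx le_rfl)
    refine ⟨-(InnerProductSpace.toDual ℝ E3).symm f, ?_, ?_⟩
    · rintro _ ⟨z, hz, rfl⟩
      rw [inner_neg_left, InnerProductSpace.toDual_symm_apply]
      by_contra! h
      have hfz : 0 < f z := by linarith
      have := hf _ (smul_mem_coneOver hz (by positivity : 0 ≤ s / f z))
      rw [map_smul, smul_eq_mul, div_mul_cancel₀ _ hfz.ne'] at this
      exact lt_irrefl _ this
    · rw [inner_neg_left, InnerProductSpace.toDual_symm_apply, ← map_neg]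
      exact hs.trans hfx
  choose! Y hYD hYpos using hpt
  have hWc : IsCompact W := hcl.isCompact
  obtain ⟨T, hTW, hT⟩ := hWc.elim_nhds_subcover (fun x => {z : S2 | 0 < ⟪Y x, (z : E3)⟫})
    (fun x hx => (isOpen_lt continuous_const (by fun_prop)).mem_nhds (hYpos x hx))
  have hpos : ∀ z ∈ W, 0 < ⟪∑ x ∈ T, Y x, (z : E3)⟫ := fun z hz => by
    obtain ⟨x, hx, hxz⟩ := Set.mem_iUnion₂.1 (hT hz)
    rw [sum_inner]
    exact Finset.sum_pos' (fun i hi => hYD i (hTW i hi) _ ⟨z, hz, rfl⟩) ⟨x, hx, hxz⟩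
  obtain ⟨p, hp, hmin⟩ := hWc.exists_isMinOn hne
    (f := fun z : S2 => ⟪∑ x ∈ T, Y x, (z : E3)⟫) (by fun_prop)
  refine ⟨∑ x ∈ T, Y x, _, hpos p hp, ?_⟩
  rintro _ ⟨z, hz, rfl⟩
  exact hmin hz

end Cone

theorem left_mem_arc (a b : S2) : a ∈ arc a b := ⟨1, 0, by simp⟩

theorem right_mem_arc (a b : S2) : b ∈ arc a b := ⟨0, 1, by simp⟩

end SphericalGeometry

/-! ### Translation of constant width into constant polar diameter. -/

theorem theorem6 (W : Set SphericalGeometry.S2) (w : ℝ)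
    (hW : SphericalGeometry.IsConvexBody W)
    (hw : SphericalGeometry.HasConstantWidth W w)
    (hlt : w < Real.pi / 2) :
    SphericalGeometry.IsStrictlyConvex W := by
  open SphericalGeometry in
  intro a b hab hab' harc
  have hcl : IsClosed W := hW.1
  have ha : a ∈ W := hcl.frontier_subset (harc (left_mem_arc a b))
  have hb : b ∈ W := hcl.frontier_subset (harc (right_mem_arc a b))
  set V : Set (EuclideanSpace ℝ (Fin 3)) := Subtype.val '' W with hV
  have hab0 : (a : EuclideanSpace ℝ (Fin 3)) + b ≠ 0 := fun h =>
    hab' (Subtype.ext (eq_neg_of_add_eq_zero_left h))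
  -- Support at the midpoint of the arc: the inner products of `k` with `a` and `b` are non-negative
  -- with sum zero, so both vanish.
  obtain ⟨k, hk, hkm⟩ := exists_mem_dualBoundary hW (p := toS2 _ hab0) (harc
    ⟨_, _, inv_nonneg.2 (norm_nonneg _), inv_nonneg.2 (norm_nonneg _), smul_add _ _ _⟩)
  rw [inner_toS2, div_eq_zero_iff, or_iff_left (norm_ne_zero_iff.2 hab0), inner_add_right] at hkm
  have hka := hk.2.1 _ ⟨a, ha, rfl⟩
  have hkb := hk.2.1 _ ⟨b, hb, rfl⟩
  have hattain : ∀ k ∈ dualBoundary V, ∃ k' ∈ dualBoundary V, k ≠ -k' ∧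
      inner ℝ k k' = -Real.cos w ∧ 0 ≤ w := fun k hk => by
    lift k to S2 using mem_sphere_zero_iff_norm.2 hk.1
    obtain ⟨k', hk', hkk'⟩ := (hw k ((mem_dualBoundary_iff_supports hcl).1 hk)).1
    refine ⟨k', (mem_dualBoundary_iff_supports hcl).2 hk', fun h => hkk'.2.1 (Subtype.ext h), ?_,
      hkk'.mem_Icc.1⟩
    rw [hkk'.cos_eq, neg_neg]
  have hdiam : ∀ k ∈ dualBoundary V, ∀ k' ∈ dualBoundary V, k ≠ k' → k ≠ -k' →
      -Real.cos w ≤ inner ℝ k k' := fun k hk k' hk' hne hne' => by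
    obtain ⟨-, -, -, -, hw0⟩ := hattain k hk
    lift k to S2 using mem_sphere_zero_iff_norm.2 hk.1
    lift k' to S2 using mem_sphere_zero_iff_norm.2 hk'.1
    obtain ⟨t, ht⟩ := exists_hasLuneThickness (g := k) (h := k')
      (fun h => hne (congrArg _ h)) (fun h => hne' (congrArg Subtype.val h))
    have hwt := (hw k ((mem_dualBoundary_iff_supports hcl).1 hk)).2
      ⟨k', (mem_dualBoundary_iff_supports hcl).1 hk', ht⟩
    have := Real.cos_le_cos_of_nonneg_of_le_pi hw0 ht.mem_Icc.2 hwt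
    rw [ht.cos_eq] at this
    linarith
  obtain ⟨k', hk', hne, hkk', hw0⟩ := hattain k hk
  -- Width zero would make the two centers antipodal, which the definition of a lune excludes.
  have hγ1 : Real.cos w < 1 := lt_of_le_of_ne (Real.cos_le_one w) fun h =>
    hne ((inner_eq_neg_one_iff_of_norm_eq_one (𝕜 := ℝ) hk.1 hk'.1).1 (by rw [hkk', h]))
  obtain ⟨q, r, hr, hq⟩ := exists_pos_le_inner hcl hW.2.1
  refine hab (Subtype.ext (eq_of_inner_eq_zero (hcl.isCompact.image continuous_subtype_val)
    ?_ ?_ (Real.cos_pos_of_mem_Ioo ⟨by linarith, hlt⟩) hdiam hγ1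
    (fun k hk => let ⟨k', h1, _, h2, _⟩ := hattain k hk; ⟨k', h1, h2⟩) hr hq hk
    ⟨a, ha, rfl⟩ ⟨b, hb, rfl⟩ (by linarith) (by linarith)))
  · rintro _ ⟨x, -, rfl⟩
    exact x.norm_eq_one
  · intro y hy hy0
    obtain ⟨u, hu⟩ := hW.2.2
    exact ⟨u, ⟨u, interior_subset hu, rfl⟩, inner_pos_of_mem_interior hy hy0 hu⟩
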